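/- Let $\Bbbk$ be a field and, for $n\ge 1$, let $R_n=\Bbbk[x_1,\dots,x_n]$ with its standard grading. Let $\mathrm{Inc}$ be the monoid of strictly increasing maps $\pi$ from the positive integers to themselves, acting by $\pi(x_i)=x_{\pi(i)}$. Let $\mathcal I=(I_n)_{n\ge 1}$ be an $\mathrm{Inc}$-invariant chain of ideals $I_n\subseteq R_n$, i.e. $\pi(I_m)\subseteq I_n$ for all $1\le m<n$ and all $\pi\in\mathrm{Inc}$ with $\pi(m)\le n$. Assume that each $I_n$ is an edge ideal (generated by a possibly empty set of squarefree quadratic monomials) and that $I_n\ne 0$ for all sufficiently large $n$. Then the chain stabilizes: there is a smallest integer $r\ge 1$ (the stability index of $\mathcal I$) such that for every $n\ge r$ the ideal $I_n$ is generated by $\bigcup\{\pi(I_r) : \pi\in\mathrm{Inc},\ \pi(r)\le n\}$. For this $r$, $$\operatorname{reg} I_n\le 3\qquad\text{for all } n\ge 4r,$$ where $\operatorname{reg} M=\sup\{j-i : \operatorname{Tor}_i^{R_n}(\Bbbk,M)_j\ne 0\}$ is the Castelnuovo–Mumford regularity of a finitely generated graded $R_n$-module $M$. -/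

import Mathlib

open scoped TensorProduct

noncomputable section

namespace IncChain

universe u v w

/-! ## Graded free modules over a polynomial ring -/

/-- The degree `j` part of the standard graded polynomial ring `K[x_s : s ∈ σ]`, for `j : ℤ`
(it is zero for `j < 0`). -/
abbrev polyPart (K : Type u) [Field K] (σ : Type v) (j : ℤ) :
    Submodule K (MvPolynomial σ K) :=
  MvPolynomial.weightedHomogeneousSubmodule K (fun _ : σ => (1 : ℤ)) j

section GradedFree

variable {K : Type u} [Field K] {σ : Type v} {ι κ : Type w}

/-- An element `x` of the graded free module `⨁ b, S(-deg b)` is homogeneous of degree `e`. -/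
def IsHomog (deg : ι → ℤ) (e : ℤ) (x : ι →₀ MvPolynomial σ K) : Prop :=
  ∀ b, x b ∈ polyPart K σ (e - deg b)

end GradedFree

/-- A graded free resolution
`⋯ → F 1 → F 0 → K → 0` of the residue field `K = S / (x_s : s ∈ σ)` over the standard graded
polynomial ring `S = K[x_s : s ∈ σ]`, where `F i = ⨁ a : ι i, S(-deg i a)` and all maps are
`S`-linear and homogeneous of degree `0`. -/
structure GradedFreeResolution (K : Type u) [Field K] (σ : Type v) where
  /-- the basis of the `i`-th free module -/
  ι : ℕ → Type (max u v)
  /-- the degrees of the basis elements -/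
  deg : ∀ i, ι i → ℤ
  /-- the differentials -/
  d : ∀ i, (ι (i + 1) →₀ MvPolynomial σ K) →ₗ[MvPolynomial σ K] (ι i →₀ MvPolynomial σ K)
  /-- the augmentation -/
  aug : (ι 0 →₀ MvPolynomial σ K) →ₗ[MvPolynomial σ K]
    (MvPolynomial σ K ⧸ MvPolynomial.idealOfVars σ K)
  d_homog : ∀ i a, IsHomog (deg i) (deg (i + 1) a) (d i (Finsupp.single a 1))
  aug_homog : ∀ a, ∃ p ∈ polyPart K σ (deg 0 a),
    aug (Finsupp.single a 1) = Ideal.Quotient.mk (MvPolynomial.idealOfVars σ K) p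
  exact_d : ∀ i, Function.Exact (d (i + 1)) (d i)
  exact_aug : Function.Exact (d 0) aug
  aug_surjective : Function.Surjective aug

/-! ### Existence of graded free resolutions of the residue field -/

section Existence

variable {K : Type u} [Field K] {σ : Type v} {ι κ : Type w}

/-- The degree `e` component of an element of the graded free module `⨁ b, S(-deg b)`. -/
def comp (deg : ι → ℤ) (e : ℤ) :
    (ι →₀ MvPolynomial σ K) →ₗ[K] (ι →₀ MvPolynomial σ K) :=
  Finsupp.lsum K fun a => (Finsupp.lsingle a).comp
    (MvPolynomial.weightedHomogeneousComponent (fun _ : σ => (1 : ℤ)) (e - deg a))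

lemma comp_single (deg : ι → ℤ) (e : ℤ) (a : ι) (p : MvPolynomial σ K) :
    comp deg e (Finsupp.single a p) = Finsupp.single a
      (MvPolynomial.weightedHomogeneousComponent (fun _ : σ => (1 : ℤ)) (e - deg a) p) := by
  simp [comp]

lemma comp_apply (deg : ι → ℤ) (e : ℤ) (x : ι →₀ MvPolynomial σ K) (b : ι) :
    comp deg e x b =
      MvPolynomial.weightedHomogeneousComponent (fun _ : σ => (1 : ℤ)) (e - deg b) (x b) := by
  classical
  induction x using Finsupp.induction_linear with
  | zero => simp
  | add f g hf hg => simp [hf, hg]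
  | single a p =>
    rw [comp_single]
    by_cases h : a = b
    · subst h; simp
    · simp [h]

lemma isHomog_comp (deg : ι → ℤ) (e : ℤ) (x : ι →₀ MvPolynomial σ K) :
    IsHomog deg e (comp deg e x) := by
  intro b
  rw [comp_apply]
  exact MvPolynomial.weightedHomogeneousComponent_mem _ _ _

lemma comp_of_isHomog (deg : ι → ℤ) {e e' : ℤ} {x : ι →₀ MvPolynomial σ K}
    (hx : IsHomog deg e' x) : comp deg e x = if e = e' then x else 0 := by
  ext1 b
  rw [comp_apply, MvPolynomial.weightedHomogeneousComponent_of_mem (hx b)]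
  by_cases h : e = e'
  · simp [h]
  · simp [h]

lemma isHomog_single_monomial (deg : ι → ℤ) (a : ι) (s : σ →₀ ℕ) (c : K) :
    IsHomog deg (deg a + Finsupp.weight (fun _ : σ => (1 : ℤ)) s)
      (Finsupp.single a (MvPolynomial.monomial s c)) := by
  classical
  intro b
  by_cases h : a = b
  · subst h
    rw [Finsupp.single_eq_same]
    exact MvPolynomial.isWeightedHomogeneous_monomial _ _ _ (by ring)
  · rw [Finsupp.single_eq_of_ne' h]
    exact Submodule.zero_mem _

/-- Elements of a free module are sums of terms `monomial * basis element`. -/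
lemma single_induction {P : (ι →₀ MvPolynomial σ K) → Prop} (x : ι →₀ MvPolynomial σ K)
    (h0 : P 0) (hadd : ∀ f g, P f → P g → P (f + g))
    (hs : ∀ a s c, P (Finsupp.single a (MvPolynomial.monomial s c))) : P x := by
  induction x using Finsupp.induction_linear with
  | zero => exact h0
  | add f g hf hg => exact hadd f g hf hg
  | single a p =>
    induction p using MvPolynomial.induction_on' with
    | monomial s c => exact hs a s c
    | add p q hp hq => rw [Finsupp.single_add]; exact hadd _ _ hp hq

lemma exists_sum_comp (deg : ι → ℤ) (x : ι →₀ MvPolynomial σ K) :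
    ∃ E : Finset ℤ, ∀ E', E ⊆ E' → ∑ e ∈ E', comp deg e x = x := by
  classical
  induction x using single_induction with
  | h0 => exact ⟨∅, by simp⟩
  | hadd f g hf hg =>
    obtain ⟨E, hE⟩ := hf
    obtain ⟨F, hF⟩ := hg
    refine ⟨E ∪ F, fun E' h => ?_⟩
    simp only [map_add, Finset.sum_add_distrib]
    rw [hE E' (Finset.union_subset_left h), hF E' (Finset.union_subset_right h)]
  | hs a s c =>
    refine ⟨{deg a + Finsupp.weight (fun _ : σ => (1 : ℤ)) s}, fun E' h => ?_⟩
    simp only [comp_of_isHomog deg (isHomog_single_monomial deg a s c)]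
    rw [Finset.sum_ite_eq', if_pos (h (Finset.mem_singleton_self _))]

/-- A submodule of a graded free module is graded if it contains the homogeneous components of its
elements. -/
def IsGradedSub (deg : ι → ℤ)
    (N : Submodule (MvPolynomial σ K) (ι →₀ MvPolynomial σ K)) : Prop :=
  ∀ x ∈ N, ∀ e, comp deg e x ∈ N

/-- The homogeneous elements of `N`, together with their degree. -/
abbrev HomogElts (deg : ι → ℤ)
    (N : Submodule (MvPolynomial σ K) (ι →₀ MvPolynomial σ K)) :=
  {y : ℤ × (ι →₀ MvPolynomial σ K) // y.2 ∈ N ∧ IsHomog deg y.1 y.2}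

/-- The map onto `N` from the graded free module on the homogeneous elements of `N`. -/
def cover (deg : ι → ℤ) (N : Submodule (MvPolynomial σ K) (ι →₀ MvPolynomial σ K)) :
    (HomogElts deg N →₀ MvPolynomial σ K) →ₗ[MvPolynomial σ K] (ι →₀ MvPolynomial σ K) :=
  Finsupp.linearCombination (MvPolynomial σ K) fun y => y.1.2

lemma range_cover (deg : ι → ℤ) (N : Submodule (MvPolynomial σ K) (ι →₀ MvPolynomial σ K))
    (hN : IsGradedSub deg N) : LinearMap.range (cover deg N) = N := by
  apply le_antisymm
  · rw [cover, Finsupp.range_linearCombination, Submodule.span_le]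
    rintro _ ⟨y, rfl⟩
    exact y.2.1
  · intro x hx
    obtain ⟨E, hE⟩ := exists_sum_comp deg x
    rw [← hE E subset_rfl]
    refine Submodule.sum_mem _ fun e _ => ?_
    refine ⟨Finsupp.single ⟨(e, comp deg e x), hN x hx e, isHomog_comp deg e x⟩ 1, ?_⟩
    rw [cover, Finsupp.linearCombination_single, one_smul]

lemma isHomog_map {deg : ι → ℤ} {deg' : κ → ℤ}
    (f : (κ →₀ MvPolynomial σ K) →ₗ[MvPolynomial σ K] (ι →₀ MvPolynomial σ K))
    (hf : ∀ a, IsHomog deg (deg' a) (f (Finsupp.single a 1))) (a : κ) (s : σ →₀ ℕ) (c : K) :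
    IsHomog deg (deg' a + Finsupp.weight (fun _ : σ => (1 : ℤ)) s)
      (f (Finsupp.single a (MvPolynomial.monomial s c))) := by
  have h1 : (Finsupp.single a (MvPolynomial.monomial s c) : κ →₀ MvPolynomial σ K)
      = MvPolynomial.monomial s c • Finsupp.single a 1 := by simp
  intro b
  rw [h1, map_smul, Finsupp.smul_apply, smul_eq_mul]
  have h2 := MvPolynomial.IsWeightedHomogeneous.mul
    (MvPolynomial.isWeightedHomogeneous_monomial (fun _ : σ => (1 : ℤ)) s c rfl) (hf a b)
  have h3 : deg' a + Finsupp.weight (fun _ : σ => (1 : ℤ)) s - deg b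
      = Finsupp.weight (fun _ : σ => (1 : ℤ)) s + (deg' a - deg b) := by ring
  rw [h3]
  exact h2

lemma comp_map {deg : ι → ℤ} {deg' : κ → ℤ}
    (f : (κ →₀ MvPolynomial σ K) →ₗ[MvPolynomial σ K] (ι →₀ MvPolynomial σ K))
    (hf : ∀ a, IsHomog deg (deg' a) (f (Finsupp.single a 1))) (e : ℤ)
    (x : κ →₀ MvPolynomial σ K) : comp deg e (f x) = f (comp deg' e x) := by
  induction x using single_induction with
  | h0 => simp
  | hadd x y hx hy => simp [hx, hy]
  | hs a s c =>
    rw [comp_of_isHomog deg (isHomog_map f hf a s c),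
      comp_of_isHomog deg' (isHomog_single_monomial deg' a s c)]
    split_ifs <;> simp

lemma isGradedSub_ker {deg : ι → ℤ} {deg' : κ → ℤ}
    (f : (κ →₀ MvPolynomial σ K) →ₗ[MvPolynomial σ K] (ι →₀ MvPolynomial σ K))
    (hf : ∀ a, IsHomog deg (deg' a) (f (Finsupp.single a 1))) :
    IsGradedSub deg' (LinearMap.ker f) := by
  intro x hx e
  rw [LinearMap.mem_ker] at hx ⊢
  rw [← comp_map f hf, hx, map_zero]

lemma isHomog_cover (deg : ι → ℤ)
    (N : Submodule (MvPolynomial σ K) (ι →₀ MvPolynomial σ K)) (y : HomogElts deg N) :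
    IsHomog deg y.1.1 (cover deg N (Finsupp.single y 1)) := by
  rw [cover, Finsupp.linearCombination_single, one_smul]
  exact y.2.2

lemma exact_cover {P : Type*} [AddCommGroup P] [Module (MvPolynomial σ K) P] (deg : ι → ℤ)
    (f : (ι →₀ MvPolynomial σ K) →ₗ[MvPolynomial σ K] P)
    (hf : IsGradedSub deg (LinearMap.ker f)) :
    Function.Exact (cover deg (LinearMap.ker f)) f :=
  LinearMap.exact_iff.mpr (range_cover deg _ hf).symm

/-- The augmentation `S → K = S / (x_s : s ∈ σ)`. -/
def augmentation (K : Type u) [Field K] (σ : Type v) :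
    (PUnit.{w + 1} →₀ MvPolynomial σ K) →ₗ[MvPolynomial σ K]
      (MvPolynomial σ K ⧸ MvPolynomial.idealOfVars σ K) :=
  Finsupp.linearCombination (MvPolynomial σ K) fun _ => Ideal.Quotient.mk _ 1

lemma augmentation_apply (x : PUnit.{w + 1} →₀ MvPolynomial σ K) :
    augmentation K σ x = Ideal.Quotient.mk (MvPolynomial.idealOfVars σ K) (x PUnit.unit) := by
  obtain ⟨p, rfl⟩ : ∃ p, x = Finsupp.single PUnit.unit p := ⟨x PUnit.unit, by ext; simp⟩
  rw [augmentation, Finsupp.linearCombination_single, Finsupp.single_eq_same,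
    ← Ideal.Quotient.mk_eq_mk, ← Ideal.Quotient.mk_eq_mk, ← Submodule.Quotient.mk_smul,
    smul_eq_mul, mul_one]

lemma comp_mem_idealOfVars (p : MvPolynomial σ K) (hp : p ∈ MvPolynomial.idealOfVars σ K)
    (e : ℤ) : MvPolynomial.weightedHomogeneousComponent (fun _ : σ => (1 : ℤ)) e p ∈
      MvPolynomial.idealOfVars σ K := by
  classical
  rw [← pow_one (MvPolynomial.idealOfVars σ K), MvPolynomial.mem_pow_idealOfVars_iff'] at hp ⊢
  intro x hx
  rw [MvPolynomial.coeff_weightedHomogeneousComponent, hp x hx, ite_self]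

lemma isGradedSub_ker_augmentation :
    IsGradedSub (fun _ : PUnit.{w + 1} => (0 : ℤ)) (LinearMap.ker (augmentation K σ)) := by
  intro x hx e
  rw [LinearMap.mem_ker, augmentation_apply, Ideal.Quotient.eq_zero_iff_mem] at hx ⊢
  rw [comp_apply]
  exact comp_mem_idealOfVars _ hx _

end Existence

/-- A graded free module with a graded submodule: one stage in the construction of a graded free
resolution. -/
structure ResolutionStage (K : Type u) [Field K] (σ : Type v) where
  ι : Type (max u v)
  deg : ι → ℤ
  N : Submodule (MvPolynomial σ K) (ι →₀ MvPolynomial σ K)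
  graded : IsGradedSub deg N

/-- The next stage: cover the submodule by a graded free module, and take the kernel. -/
def ResolutionStage.next {K : Type u} [Field K] {σ : Type v} (A : ResolutionStage K σ) :
    ResolutionStage K σ where
  ι := HomogElts A.deg A.N
  deg := fun y => y.1.1
  N := LinearMap.ker (cover A.deg A.N)
  graded := isGradedSub_ker _ (isHomog_cover A.deg A.N)

/-- The first stage: the free module `S` with the submodule `(x_s : s ∈ σ)`. -/
def ResolutionStage.first (K : Type u) [Field K] (σ : Type v) : ResolutionStage K σ where
  ι := PUnit
  deg := fun _ => 0
  N := LinearMap.ker (augmentation K σ)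
  graded := isGradedSub_ker_augmentation

/-- The stages of the construction. -/
def resolutionStage (K : Type u) [Field K] (σ : Type v) : ℕ → ResolutionStage K σ
  | 0 => ResolutionStage.first K σ
  | i + 1 => (resolutionStage K σ i).next

/-- A graded free resolution of the residue field. In each step, all homogeneous elements of the
kernel are used as generators. -/
def standardResolution (K : Type u) [Field K] (σ : Type v) : GradedFreeResolution K σ where
  ι := fun i => (resolutionStage K σ i).ι
  deg := fun i => (resolutionStage K σ i).deg
  d := fun i => cover (resolutionStage K σ i).deg (resolutionStage K σ i).N
  aug := augmentation K σ
  d_homog := fun i a => isHomog_cover _ _ a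
  aug_homog := fun a => ⟨1, MvPolynomial.isWeightedHomogeneous_one _ _, by
    refine (augmentation_apply _).trans ?_
    exact congrArg _ Finsupp.single_eq_same⟩
  exact_d := fun i => exact_cover (resolutionStage K σ (i + 1)).deg
    (cover (resolutionStage K σ i).deg (resolutionStage K σ i).N)
    (resolutionStage K σ (i + 1)).graded
  exact_aug := exact_cover (fun _ => 0) (augmentation K σ) isGradedSub_ker_augmentation
  aug_surjective := fun y => by
    obtain ⟨p, rfl⟩ := Ideal.Quotient.mk_surjective y
    refine ⟨Finsupp.single PUnit.unit p, (augmentation_apply _).trans ?_⟩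
    exact congrArg _ Finsupp.single_eq_same

/-! ## Graded Tor and Castelnuovo–Mumford regularity -/

section Tor

variable {K : Type u} [Field K] {σ : Type v} {M : Type w} [AddCommGroup M]
  [Module (MvPolynomial σ K) M]

/-- The degree `j` part of `F i ⊗ M`, where `F` is a graded free resolution and `M = ⨁ j, 𝓜 j` is
a graded module. -/
def tensorPart (F : GradedFreeResolution K σ) (𝓜 : ℤ → AddSubgroup M) (i : ℕ) (j : ℤ) :
    AddSubgroup ((F.ι i →₀ MvPolynomial σ K) ⊗[MvPolynomial σ K] M) :=
  AddSubgroup.closure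
    {t | ∃ a, ∃ m ∈ 𝓜 (j - F.deg i a), t = Finsupp.single a (1 : MvPolynomial σ K) ⊗ₜ m}

/-- The cycles of degree `j` in `F i ⊗ M`. -/
def torCycles (F : GradedFreeResolution K σ) (𝓜 : ℤ → AddSubgroup M) (i : ℕ) (j : ℤ) :
    AddSubgroup ((F.ι i →₀ MvPolynomial σ K) ⊗[MvPolynomial σ K] M) :=
  match i with
  | 0 => tensorPart F 𝓜 0 j
  | i + 1 => tensorPart F 𝓜 (i + 1) j ⊓ (LinearMap.ker ((F.d i).rTensor M)).toAddSubgroup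

/-- The boundaries of degree `j` in `F i ⊗ M`. -/
def torBoundaries (F : GradedFreeResolution K σ) (𝓜 : ℤ → AddSubgroup M) (i : ℕ) (j : ℤ) :
    AddSubgroup ((F.ι i →₀ MvPolynomial σ K) ⊗[MvPolynomial σ K] M) :=
  (tensorPart F 𝓜 (i + 1) j).map ((F.d i).rTensor M).toAddMonoidHom

/-- `Tor_i^S(K, M)_j`, the degree `j` part of the `i`-th homology of `F ⊗ M`, where `F` is a
graded free resolution of `K` over `S = K[x_s : s ∈ σ]` and `M = ⨁ j, 𝓜 j` is a graded
`S`-module. As for every derived functor, the choice of `F` does not matter. -/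
abbrev GradedTor (K : Type u) [Field K] (σ : Type v) {M : Type w} [AddCommGroup M]
    [Module (MvPolynomial σ K) M] (𝓜 : ℤ → AddSubgroup M) (i : ℕ) (j : ℤ) : Type _ :=
  torCycles (standardResolution K σ) 𝓜 i j ⧸
    (torBoundaries (standardResolution K σ) 𝓜 i j).addSubgroupOf
      (torCycles (standardResolution K σ) 𝓜 i j)

end Tor

/-- The Castelnuovo–Mumford regularity `sup {j - i : Tor_i^S(K, M)_j ≠ 0}` of a graded module
`M = ⨁ j, 𝓜 j` over `S = K[x_s : s ∈ σ]`. The supremum is taken in the extended reals, so that the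
regularity of the zero module is `-∞`. -/
def regularity (K : Type u) [Field K] (σ : Type v) {M : Type w} [AddCommGroup M]
    [Module (MvPolynomial σ K) M] (𝓜 : ℤ → AddSubgroup M) : EReal :=
  sSup {x | ∃ (i : ℕ) (j : ℤ), Nontrivial (GradedTor K σ 𝓜 i j) ∧ x = (((j - i : ℤ) : ℝ) : EReal)}

/-- The standard grading of a (homogeneous) ideal `J` of the polynomial ring. -/
def idealPart {K : Type u} [Field K] {σ : Type v} (J : Ideal (MvPolynomial σ K)) (j : ℤ) :
    AddSubgroup J :=
  (polyPart K σ j).toAddSubgroup.comap (Submodule.subtype J).toAddMonoidHom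

/-- The Castelnuovo–Mumford regularity of a (homogeneous) ideal, as a graded module. -/
def idealReg {K : Type u} [Field K] {σ : Type v} (J : Ideal (MvPolynomial σ K)) : EReal :=
  regularity K σ (idealPart J)

/-! ## Edge ideals and `Inc`-invariant chains -/

/-- The edge ideal of a simple graph. -/
def edgeIdeal (K : Type u) [Field K] {V : Type v} (G : SimpleGraph V) :
    Ideal (MvPolynomial V K) :=
  Ideal.span {p | ∃ a b, G.Adj a b ∧ p = MvPolynomial.X a * MvPolynomial.X b}

/-- An ideal is an edge ideal if it is generated by squarefree quadratic monomials (possibly by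
none of them). -/
def IsEdgeIdeal {K : Type u} [Field K] {V : Type v} (J : Ideal (MvPolynomial V K)) : Prop :=
  ∃ G : SimpleGraph V, J = edgeIdeal K G

/-- The polynomial ring `R_n = K[x_1, …, x_n]`; its variables are indexed by the positive integers
`i ≤ n`. -/
abbrev PolyRing (K : Type u) [Field K] (n : ℕ+) : Type u := MvPolynomial (Set.Iic n) K

/-- The strictly increasing functions from the positive integers to themselves. -/
abbrev Inc : Type := ℕ+ ↪o ℕ+

/-- The map `R_m → R_n`, `x_i ↦ x_{π(i)}`, for a strictly increasing `π` with `π(m) ≤ n`. -/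
def incMap (K : Type u) [Field K] {m n : ℕ+} (π : Inc) (h : π m ≤ n) :
    PolyRing K m →ₐ[K] PolyRing K n :=
  MvPolynomial.rename fun i : Set.Iic m => ⟨π i, (π.monotone i.2).trans h⟩

/-- A family of ideals `I_n ⊆ R_n`, `n ≥ 1`, is an `Inc`-invariant chain. -/
def IsIncInvariantChain {K : Type u} [Field K] (I : ∀ n : ℕ+, Ideal (PolyRing K n)) : Prop :=
  ∀ m n : ℕ+, m < n → ∀ (π : Inc) (h : π m ≤ n), ∀ f ∈ I m, incMap K π h f ∈ I n

/-- The ideal of `R_n` generated by the sets `π(J)`, where `π` runs over the strictly increasing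
functions with `π(m) ≤ n`. -/
def orbitIdeal {K : Type u} [Field K] {m : ℕ+} (J : Ideal (PolyRing K m)) (n : ℕ+) :
    Ideal (PolyRing K n) :=
  Ideal.span {g | ∃ (π : Inc) (h : π m ≤ n), ∃ f ∈ J, incMap K π h f = g}

/-- The chain is generated by its `r`-th member from `r` on. -/
def StabilizesAt {K : Type u} [Field K] (I : ∀ n : ℕ+, Ideal (PolyRing K n)) (r : ℕ+) : Prop :=
  ∀ n : ℕ+, r ≤ n → I n = orbitIdeal (I r) n

/-- `r` is the stability index of the chain: the smallest `r` with `StabilizesAt I r`. -/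
def IsStabilityIndex {K : Type u} [Field K] (I : ∀ n : ℕ+, Ideal (PolyRing K n)) (r : ℕ+) :
    Prop :=
  IsLeast {s | StabilizesAt I s} r

end IncChain

end

open scoped TensorProduct

noncomputable section

namespace IncChain

universe u v w

/-! ## Tor of ideals inside the resolution -/

section TorIdeal

variable {K : Type u} [Field K] {σ : Type v} {ι κ : Type w}

/-! Record an edge `v < w` at level `n` by its gaps `(v - 1, w - v - 1, n - w)`. Increasing maps can
carry one edge to another exactly when no gap shrinks (`Inc.add_le_add`, `exists_inc`). So the gap
triples of all edges form an up-set in `ℕ³`, and Dickson's lemma gives stabilization. From `r` on,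
the edges of `I_n` are the pairs whose gaps dominate one of a fixed set of triples of sum `r - 2`.

The regularity bound rests on `reg I(G) ≤ max (reg I(G - N[x]) + 1) (reg I(G - x))`, up to a floor
of `2`. It comes from the Mayer-Vietoris estimate `RegLE.sup`, applied to `I` as the sum of `x (I :
x)` and the ideal generated by the monomials of `I` free of `x`. Peeling off all vertices in a
chosen order (`RegLE.of_rank`), each peeled vertex leaves the graph on its non-neighbours among the
vertices still present, and one such round costs one unit of regularity. For `n ≥ 4r` each vertex is
so far from one end of `{1, …, n}` that the corresponding gap condition is automatic. Two rounds in
suitable orders then leave only edgeless graphs (`regLE_three_of_staircase`), whence `1 + 1 + 1 =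
3`. -/

lemma isHomog_iff_comp_eq (deg : ι → ℤ) (e : ℤ) (x : ι →₀ MvPolynomial σ K) :
    IsHomog deg e x ↔ comp deg e x = x :=
  ⟨fun h => by rw [comp_of_isHomog deg h, if_pos rfl], fun h => h ▸ isHomog_comp deg e x⟩

lemma IsHomog.map {deg : ι → ℤ} {deg' : κ → ℤ}
    {f : (κ →₀ MvPolynomial σ K) →ₗ[MvPolynomial σ K] (ι →₀ MvPolynomial σ K)}
    (hf : ∀ a, IsHomog deg (deg' a) (f (Finsupp.single a 1))) {e : ℤ}
    {x : κ →₀ MvPolynomial σ K} (hx : IsHomog deg' e x) : IsHomog deg e (f x) := by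
  rw [isHomog_iff_comp_eq] at hx ⊢
  rw [comp_map f hf, hx]

lemma IsHomog.add {deg : ι → ℤ} {e : ℤ} {x y : ι →₀ MvPolynomial σ K}
    (hx : IsHomog deg e x) (hy : IsHomog deg e y) : IsHomog deg e (x + y) :=
  fun b => add_mem (hx b) (hy b)

lemma IsHomog.sub {deg : ι → ℤ} {e : ℤ} {x y : ι →₀ MvPolynomial σ K}
    (hx : IsHomog deg e x) (hy : IsHomog deg e y) : IsHomog deg e (x - y) :=
  fun b => sub_mem (hx b) (hy b)

lemma map_apply_mem {J : Ideal (MvPolynomial σ K)}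
    (f : (κ →₀ MvPolynomial σ K) →ₗ[MvPolynomial σ K] (ι →₀ MvPolynomial σ K))
    {x : κ →₀ MvPolynomial σ K} (hx : ∀ a, x a ∈ J) (b : ι) : f x b ∈ J := by
  have h : f x = ∑ a ∈ x.support, x a • f (Finsupp.single a 1) := by
    conv_lhs => rw [← Finsupp.sum_single x, Finsupp.sum, map_sum]
    refine Finset.sum_congr rfl fun a _ => ?_
    rw [← map_smul, Finsupp.smul_single_one]
  rw [h, Finsupp.finsetSum_apply]
  refine Ideal.sum_mem _ fun a _ => ?_
  rw [Finsupp.smul_apply, smul_eq_mul]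
  exact J.mul_mem_right _ (hx a)

/-- The condition of being a cycle in a resolution, which is empty in homological degree `0`. -/
def GradedFreeResolution.IsCycle (F : GradedFreeResolution K σ) :
    ∀ i, (F.ι i →₀ MvPolynomial σ K) → Prop
  | 0, _ => True
  | i + 1, x => F.d i x = 0

/-- The vanishing of `Tor_i(K, J)_j` for an ideal `J`, where `F i ⊗ J` is identified with the
elements of `F i` all of whose coordinates lie in `J`. -/
def TorVanishes (F : GradedFreeResolution K σ) (J : Ideal (MvPolynomial σ K)) (i : ℕ) (j : ℤ) :
    Prop :=
  ∀ x, (∀ a, x a ∈ J) → IsHomog (F.deg i) j x → F.IsCycle i x →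
    ∃ y, (∀ a, y a ∈ J) ∧ IsHomog (F.deg (i + 1)) j y ∧ F.d i y = x

/-- The inclusion of `F ⊗ J` into the free module `F`. -/
def tensorIdealMap (ι : Type w) (J : Ideal (MvPolynomial σ K)) :
    ((ι →₀ MvPolynomial σ K) ⊗[MvPolynomial σ K] J) →ₗ[MvPolynomial σ K]
      (ι →₀ MvPolynomial σ K) :=
  (TensorProduct.rid (MvPolynomial σ K) (ι →₀ MvPolynomial σ K)).toLinearMap ∘ₗ
    (Submodule.subtype J).lTensor (ι →₀ MvPolynomial σ K)

lemma tensorIdealMap_tmul (J : Ideal (MvPolynomial σ K)) (x : ι →₀ MvPolynomial σ K) (m : J) :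
    tensorIdealMap ι J (x ⊗ₜ m) = (m : MvPolynomial σ K) • x := by
  simp [tensorIdealMap]

/-- Free modules are flat. This is what allows Tor of an ideal to be computed with elements of the
resolution instead of tensors. -/
lemma tensorIdealMap_injective (J : Ideal (MvPolynomial σ K)) :
    Function.Injective (tensorIdealMap ι J) := by
  rw [tensorIdealMap, LinearMap.coe_comp]
  exact (LinearEquiv.injective _).comp
    (Module.Flat.lTensor_preserves_injective_linearMap _ (Submodule.subtype_injective J))

lemma tensorIdealMap_rTensor (J : Ideal (MvPolynomial σ K))
    (f : (κ →₀ MvPolynomial σ K) →ₗ[MvPolynomial σ K] (ι →₀ MvPolynomial σ K))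
    (t : (κ →₀ MvPolynomial σ K) ⊗[MvPolynomial σ K] J) :
    tensorIdealMap ι J (f.rTensor J t) = f (tensorIdealMap κ J t) := by
  induction t using TensorProduct.induction_on with
  | zero => simp
  | add s t hs ht => simp only [map_add, hs, ht]
  | tmul x m => rw [LinearMap.rTensor_tmul, tensorIdealMap_tmul, tensorIdealMap_tmul, map_smul]

lemma tensorIdealMap_mem_of_mem_tensorPart (F : GradedFreeResolution K σ)
    (J : Ideal (MvPolynomial σ K)) (i : ℕ) (j : ℤ)
    {t : (F.ι i →₀ MvPolynomial σ K) ⊗[MvPolynomial σ K] J}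
    (ht : t ∈ tensorPart F (idealPart J) i j) :
    (∀ a, tensorIdealMap _ J t a ∈ J) ∧ IsHomog (F.deg i) j (tensorIdealMap _ J t) := by
  classical
  induction ht using AddSubgroup.closure_induction with
  | mem t ht =>
    obtain ⟨a, m, hm, rfl⟩ := ht
    rw [tensorIdealMap_tmul, Finsupp.smul_single_one]
    refine ⟨fun b => ?_, fun b => ?_⟩
    all_goals
      by_cases hb : a = b
      · subst hb
        rw [Finsupp.single_eq_same]
        first | exact m.2 | exact hm
      · rw [Finsupp.single_eq_of_ne' hb]
        exact Submodule.zero_mem _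
  | zero => exact ⟨fun a => by simp, fun a => by rw [map_zero]; exact Submodule.zero_mem _⟩
  | add s t _ _ hs ht =>
    rw [map_add]
    exact ⟨fun a => J.add_mem (hs.1 a) (ht.1 a), hs.2.add ht.2⟩
  | neg t _ ht =>
    rw [map_neg]
    exact ⟨fun a => J.neg_mem (ht.1 a), fun a => neg_mem (ht.2 a)⟩

lemma exists_mem_tensorPart (F : GradedFreeResolution K σ) (J : Ideal (MvPolynomial σ K))
    (i : ℕ) (j : ℤ) {x : F.ι i →₀ MvPolynomial σ K} (hx : ∀ a, x a ∈ J)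
    (hx' : IsHomog (F.deg i) j x) :
    ∃ t ∈ tensorPart F (idealPart J) i j, tensorIdealMap _ J t = x := by
  refine ⟨∑ a ∈ x.support, Finsupp.single a 1 ⊗ₜ ⟨x a, hx a⟩,
    sum_mem fun a _ => AddSubgroup.subset_closure ⟨a, ⟨x a, hx a⟩, hx' a, rfl⟩, ?_⟩
  rw [map_sum]
  conv_rhs => rw [← Finsupp.sum_single x, Finsupp.sum]
  refine Finset.sum_congr rfl fun a _ => ?_
  rw [tensorIdealMap_tmul, Finsupp.smul_single_one]

lemma TorVanishes.not_nontrivial {J : Ideal (MvPolynomial σ K)} {i : ℕ} {j : ℤ}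
    (h : TorVanishes (standardResolution K σ) J i j) :
    ¬ Nontrivial (GradedTor K σ (idealPart J) i j) := by
  rw [not_nontrivial_iff_subsingleton, QuotientAddGroup.subsingleton_iff,
    AddSubgroup.addSubgroupOf_eq_top]
  intro t ht
  have hpart : t ∈ tensorPart (standardResolution K σ) (idealPart J) i j := by
    cases i with
    | zero => exact ht
    | succ i => exact ht.1
  have hcyc : (standardResolution K σ).IsCycle i (tensorIdealMap _ J t) := by
    cases i with
    | zero => trivial
    | succ i =>
      have h2 : ((standardResolution K σ).d i).rTensor J t = 0 := ht.2
      change (standardResolution K σ).d i _ = 0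
      rw [← tensorIdealMap_rTensor, h2, map_zero]
  obtain ⟨h1, h2⟩ := tensorIdealMap_mem_of_mem_tensorPart _ J i j hpart
  obtain ⟨y, hy, hy', hyx⟩ := h _ h1 h2 hcyc
  obtain ⟨s, hs, rfl⟩ := exists_mem_tensorPart _ J (i + 1) j hy hy'
  refine ⟨s, hs, tensorIdealMap_injective J ?_⟩
  rw [← hyx]
  exact tensorIdealMap_rTensor _ _ _

/-- All nonzero `Tor_i(K, J)_j` satisfy `j - i ≤ d`. -/
def RegLE (F : GradedFreeResolution K σ) (J : Ideal (MvPolynomial σ K)) (d : ℤ) : Prop :=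
  ∀ (i : ℕ) (j : ℤ), d < j - i → TorVanishes F J i j

lemma RegLE.idealReg_le {J : Ideal (MvPolynomial σ K)} {d : ℤ}
    (h : RegLE (standardResolution K σ) J d) : idealReg J ≤ ((d : ℝ) : EReal) := by
  refine sSup_le ?_
  rintro _ ⟨i, j, hn, rfl⟩
  by_contra! hlt
  refine (h i j ?_).not_nontrivial hn
  exact_mod_cast hlt

/-! ### Regularity of the unit ideal, of multiples by a variable, and of sums -/

variable {F : GradedFreeResolution K σ}

lemma RegLE.mono {J : Ideal (MvPolynomial σ K)} {d e : ℤ} (h : RegLE F J d) (hde : d ≤ e) :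
    RegLE F J e :=
  fun i j hij => h i j (hde.trans_lt hij)

lemma regLE_bot (d : ℤ) : RegLE F (⊥ : Ideal (MvPolynomial σ K)) d := by
  intro i j _ x hx _ _
  refine ⟨0, fun a => by simp, fun a => Submodule.zero_mem _, ?_⟩
  rw [map_zero]
  ext1 a
  exact (hx a).symm

lemma GradedFreeResolution.exists_lift_of_mem_range {i : ℕ} {j : ℤ}
    {x : F.ι i →₀ MvPolynomial σ K} (hx : IsHomog (F.deg i) j x)
    (h : x ∈ Set.range (F.d i)) : ∃ y, IsHomog (F.deg (i + 1)) j y ∧ F.d i y = x := by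
  obtain ⟨y, rfl⟩ := h
  refine ⟨comp (F.deg (i + 1)) j y, isHomog_comp _ _ _, ?_⟩
  rw [← comp_map _ (F.d_homog i)]
  exact (isHomog_iff_comp_eq _ _ _).1 hx

lemma mem_idealOfVars_of_mem_polyPart {j : ℤ} (hj : j ≠ 0) {p : MvPolynomial σ K}
    (hp : p ∈ polyPart K σ j) : p ∈ MvPolynomial.idealOfVars σ K := by
  rw [← pow_one (MvPolynomial.idealOfVars σ K), MvPolynomial.mem_pow_idealOfVars_iff']
  intro x hx
  by_contra hne
  have h0 : x = 0 := by simpa [Finsupp.degree_eq_zero_iff] using hx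
  subst h0
  exact hj (by simpa using (hp hne).symm)

lemma GradedFreeResolution.aug_eq_zero {j : ℤ} (hj : j ≠ 0) {x : F.ι 0 →₀ MvPolynomial σ K}
    (hx : IsHomog (F.deg 0) j x) : F.aug x = 0 := by
  rw [← Finsupp.sum_single x, Finsupp.sum, map_sum]
  refine Finset.sum_eq_zero fun a _ => ?_
  obtain ⟨p, hp, hpa⟩ := F.aug_homog a
  rw [← Finsupp.smul_single_one, map_smul, hpa, ← Ideal.Quotient.mk_eq_mk,
    ← Submodule.Quotient.mk_smul, Submodule.Quotient.mk_eq_zero]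
  refine mem_idealOfVars_of_mem_polyPart hj ?_
  have := MvPolynomial.IsWeightedHomogeneous.mul (hx a) hp
  rwa [sub_add_cancel] at this

/-- The homology of `F` itself is `K`, placed in homological degree `0` and internal degree `0`. -/
lemma regLE_top : RegLE F (⊤ : Ideal (MvPolynomial σ K)) 0 := by
  intro i j hij x _ hx hcyc
  suffices h : x ∈ Set.range (F.d i) by
    obtain ⟨y, hy, hyx⟩ := F.exists_lift_of_mem_range hx h
    exact ⟨y, fun _ => trivial, hy, hyx⟩
  cases i with
  | zero =>
    refine (F.exact_aug x).1 (F.aug_eq_zero ?_ hx)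
    rintro rfl
    simp at hij
  | succ i => exact (F.exact_d i x).1 hcyc

lemma mem_polyPart_of_X_mul_mem {s : σ} {p : MvPolynomial σ K} {j : ℤ}
    (h : MvPolynomial.X s * p ∈ polyPart K σ j) : p ∈ polyPart K σ (j - 1) := by
  intro m hm
  have h1 : MvPolynomial.coeff (Finsupp.single s 1 + m) (MvPolynomial.X s * p) ≠ 0 := by
    rwa [MvPolynomial.coeff_X_mul]
  have h2 := h h1
  rw [map_add, Finsupp.weight_single] at h2
  simp only [one_smul] at h2
  linarith

lemma X_mul_mem_polyPart (s : σ) {p : MvPolynomial σ K} {j : ℤ}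
    (h : p ∈ polyPart K σ (j - 1)) : MvPolynomial.X s * p ∈ polyPart K σ j := by
  have := MvPolynomial.IsWeightedHomogeneous.mul
    (MvPolynomial.isWeightedHomogeneous_X K (fun _ : σ => (1 : ℤ)) s) h
  rwa [add_sub_cancel] at this

lemma X_smul_injective (s : σ) : Function.Injective
    fun x : ι →₀ MvPolynomial σ K => (MvPolynomial.X s : MvPolynomial σ K) • x :=
  fun x y h => by
    ext1 a
    exact mul_left_cancel₀ (MvPolynomial.X_ne_zero s) (DFunLike.congr_fun h a)

/-- Multiplying an ideal by a variable shifts the degrees by one. -/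
lemma RegLE.X_mul {J J' : Ideal (MvPolynomial σ K)} {d : ℤ} (h : RegLE F J d) (s : σ)
    (hJ : ∀ p, p ∈ J' ↔ ∃ q ∈ J, MvPolynomial.X s * q = p) : RegLE F J' (d + 1) := by
  intro i j hij x hx hx' hcyc
  choose g hg hgx using fun a => (hJ (x a)).1 (hx a)
  obtain ⟨x', rfl⟩ : ∃ x' : F.ι i →₀ MvPolynomial σ K,
      x = (MvPolynomial.X s : MvPolynomial σ K) • x' := by
    refine ⟨Finsupp.onFinset x.support g fun a ha => ?_, ?_⟩
    · rw [Finsupp.mem_support_iff, ← hgx a]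
      exact mul_ne_zero (MvPolynomial.X_ne_zero s) ha
    · ext1 a
      simp [hgx a]
  have hgx' : ∀ a, g a = x' a := fun a => mul_left_cancel₀ (MvPolynomial.X_ne_zero s) (hgx a)
  have hcyc' : F.IsCycle i x' := by
    cases i with
    | zero => trivial
    | succ i =>
      change F.d i _ = 0 at hcyc ⊢
      rw [map_smul] at hcyc
      refine X_smul_injective s ?_
      simpa using hcyc
  obtain ⟨y, hy, hy', hyx⟩ := h i (j - 1) (by linarith) x' (fun a => hgx' a ▸ hg a)
    (fun a => by
      have := mem_polyPart_of_X_mul_mem (hx' a)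
      rwa [sub_right_comm] at this) hcyc'
  refine ⟨(MvPolynomial.X s : MvPolynomial σ K) • y, fun a => (hJ _).2 ⟨y a, hy a, rfl⟩,
    fun a => X_mul_mem_polyPart s ?_, by rw [map_smul, hyx]⟩
  have := hy' a
  rwa [sub_right_comm] at this

/-- An ideal is homogeneous for the standard grading. -/
def IsHomogIdeal (J : Ideal (MvPolynomial σ K)) : Prop :=
  ∀ p ∈ J, ∀ e, MvPolynomial.weightedHomogeneousComponent (fun _ : σ => (1 : ℤ)) e p ∈ J

lemma exists_add_of_mem_sup {A B : Ideal (MvPolynomial σ K)} (hA : IsHomogIdeal A)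
    (hB : IsHomogIdeal B) {deg : ι → ℤ} {e : ℤ} {x : ι →₀ MvPolynomial σ K}
    (hx : ∀ a, x a ∈ A ⊔ B) (hx' : IsHomog deg e x) :
    ∃ y z, (∀ a, y a ∈ A) ∧ (∀ a, z a ∈ B) ∧ IsHomog deg e y ∧ IsHomog deg e z ∧ x = y + z := by
  classical
  choose p hp q hq hpq using fun a => Submodule.mem_sup.1 (hx a)
  -- The chosen `p a` may be nonzero where `x a = 0`; cutting it off there makes the support finite.
  let y : ι →₀ MvPolynomial σ K :=
    Finsupp.onFinset x.support (fun a => if x a = 0 then 0 else p a) fun a ha => by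
      rw [Finsupp.mem_support_iff]
      exact fun h => ha (if_pos h)
  have hyA : ∀ a, y a ∈ A := fun a => by
    change (if x a = 0 then 0 else p a) ∈ A
    split_ifs
    exacts [A.zero_mem, hp a]
  have hzB : ∀ a, (x - y) a ∈ B := fun a => by
    change x a - (if x a = 0 then 0 else p a) ∈ B
    split_ifs with h
    · rw [h, sub_zero]; exact B.zero_mem
    · rw [← hpq a, add_sub_cancel_left]; exact hq a
  refine ⟨comp deg e y, comp deg e (x - y), fun a => ?_, fun a => ?_, isHomog_comp _ _ _,
    isHomog_comp _ _ _, ?_⟩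
  · rw [comp_apply]; exact hA _ (hyA a) _
  · rw [comp_apply]; exact hB _ (hzB a) _
  · rw [← map_add, add_sub_cancel, (isHomog_iff_comp_eq _ _ _).1 hx']

lemma GradedFreeResolution.isCycle_d (i : ℕ) (x : F.ι (i + 1) →₀ MvPolynomial σ K) :
    F.IsCycle i (F.d i x) := by
  cases i with
  | zero => trivial
  | succ i => exact (F.exact_d i).apply_apply_eq_zero x

/-- The Mayer-Vietoris estimate for the regularity of a sum of ideals. -/
lemma RegLE.sup {A B : Ideal (MvPolynomial σ K)} {d : ℤ} (hA : RegLE F A d) (hB : RegLE F B d)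
    (hAB : RegLE F (A ⊓ B) (d + 1)) (hA' : IsHomogIdeal A) (hB' : IsHomogIdeal B) :
    RegLE F (A ⊔ B) d := by
  intro i j hij x hx hx' hcyc
  suffices h : ∃ y z, (∀ a, y a ∈ A) ∧ (∀ a, z a ∈ B) ∧ IsHomog (F.deg i) j y ∧
      IsHomog (F.deg i) j z ∧ F.IsCycle i y ∧ F.IsCycle i z ∧ x = y + z by
    obtain ⟨y, z, hy, hz, hy', hz', hcy, hcz, rfl⟩ := h
    obtain ⟨y₁, h1, h2, rfl⟩ := hA i j hij y hy hy' hcy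
    obtain ⟨z₁, h3, h4, rfl⟩ := hB i j hij z hz hz' hcz
    exact ⟨y₁ + z₁, fun a => add_mem (Ideal.mem_sup_left (h1 a)) (Ideal.mem_sup_right (h3 a)),
      h2.add h4, map_add _ _ _⟩
  obtain ⟨y, z, hy, hz, hy', hz', rfl⟩ := exists_add_of_mem_sup hA' hB' hx hx'
  cases i with
  | zero => exact ⟨y, z, hy, hz, hy', hz', trivial, trivial, rfl⟩
  | succ i =>
    change F.d i (y + z) = 0 at hcyc
    rw [map_add] at hcyc
    -- The element `d y = -d z` has coordinates in `A ⊓ B`. Its homological degree is one less than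
    -- that of `x`, which is why `d + 1` suffices for the intersection. A preimage `t` over `A ⊓ B`
    -- turns `y` and `z` into cycles.
    obtain ⟨t, ht, ht', hty⟩ := hAB i j (by push_cast at hij; linarith) (F.d i y)
      (fun a => ⟨map_apply_mem _ hy a, by
        rw [eq_neg_of_add_eq_zero_left hcyc]
        exact B.neg_mem (map_apply_mem _ hz a)⟩) (hy'.map (F.d_homog i)) (F.isCycle_d i y)
    refine ⟨y - t, z + t, fun a => A.sub_mem (hy a) (ht a).1, fun a => B.add_mem (hz a) (ht a).2,
      hy'.sub ht', hz'.add ht', ?_, ?_, by abel⟩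
    · change F.d i (y - t) = 0
      rw [map_sub, hty, sub_self]
    · change F.d i (z + t) = 0
      rw [map_add, hty, add_comm, hcyc]

end TorIdeal

/-! ## Squarefree monomial ideals -/

section Squarefree

variable {K : Type u} [Field K] {σ : Type v} {F : GradedFreeResolution K σ}

/-- The squarefree monomial ideal spanned by the monomials whose support satisfies `Φ`. -/
def sqfreeIdeal (K : Type u) [Field K] {σ : Type v} (Φ : Finset σ → Prop) :
    Ideal (MvPolynomial σ K) :=
  Ideal.span ((fun m => MvPolynomial.monomial m 1) '' {m : σ →₀ ℕ | Φ m.support})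

lemma mem_sqfreeIdeal {Φ : Finset σ → Prop} (hΦ : Monotone Φ) {p : MvPolynomial σ K} :
    p ∈ sqfreeIdeal K Φ ↔ ∀ m ∈ p.support, Φ m.support := by
  rw [sqfreeIdeal, MvPolynomial.mem_ideal_span_monomial_image]
  refine forall₂_congr fun m _ => ⟨?_, fun h => ⟨m, h, le_rfl⟩⟩
  rintro ⟨l, hl, hlm⟩
  exact hΦ (Finsupp.support_mono hlm) hl

lemma isHomogIdeal_sqfreeIdeal {Φ : Finset σ → Prop} (hΦ : Monotone Φ) :
    IsHomogIdeal (sqfreeIdeal K Φ) := by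
  classical
  intro p hp e
  rw [mem_sqfreeIdeal hΦ] at hp ⊢
  intro m hm
  refine hp m ?_
  rw [MvPolynomial.mem_support_iff, MvPolynomial.coeff_weightedHomogeneousComponent] at hm
  rw [MvPolynomial.mem_support_iff]
  exact fun h => hm (by rw [h, ite_self])

lemma sqfreeIdeal_sup (Φ Ψ : Finset σ → Prop) :
    sqfreeIdeal K Φ ⊔ sqfreeIdeal K Ψ = sqfreeIdeal K fun s => Φ s ∨ Ψ s := by
  rw [sqfreeIdeal, sqfreeIdeal, sqfreeIdeal, ← Ideal.span_union, ← Set.image_union]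
  rfl

lemma sqfreeIdeal_inf {Φ Ψ : Finset σ → Prop} (hΦ : Monotone Φ) (hΨ : Monotone Ψ) :
    sqfreeIdeal K Φ ⊓ sqfreeIdeal K Ψ = sqfreeIdeal K fun s => Φ s ∧ Ψ s := by
  ext p
  rw [Submodule.mem_inf, mem_sqfreeIdeal hΦ, mem_sqfreeIdeal hΨ,
    mem_sqfreeIdeal fun s t h hs => ⟨hΦ h hs.1, hΨ h hs.2⟩]
  exact ⟨fun h m hm => ⟨h.1 m hm, h.2 m hm⟩,
    fun h => ⟨fun m hm => (h m hm).1, fun m hm => (h m hm).2⟩⟩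

lemma sqfreeIdeal_false : sqfreeIdeal K (fun _ : Finset σ => False) = ⊥ := by
  simp [sqfreeIdeal]

lemma sqfreeIdeal_true : sqfreeIdeal K (fun _ : Finset σ => True) = ⊤ :=
  (Ideal.eq_top_iff_one _).2 (Ideal.subset_span ⟨0, trivial, rfl⟩)

/-- The set `s` contains an edge of the subgraph of `G` induced on `W`. -/
def HasEdgeIn (G : SimpleGraph σ) (W s : Finset σ) : Prop :=
  ∃ a ∈ W, ∃ b ∈ W, a ∈ s ∧ b ∈ s ∧ G.Adj a b

lemma hasEdgeIn_mono (G : SimpleGraph σ) (W : Finset σ) : Monotone (HasEdgeIn G W) := by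
  rintro s t hst ⟨a, ha, b, hb, has, hbs, hab⟩
  exact ⟨a, ha, b, hb, hst has, hst hbs, hab⟩

lemma regLE_of_forall_not_adj {G : SimpleGraph σ} {W : Finset σ}
    (h : ∀ a ∈ W, ∀ b ∈ W, ¬ G.Adj a b) (d : ℤ) : RegLE F (sqfreeIdeal K (HasEdgeIn G W)) d := by
  have : HasEdgeIn G W = fun _ => False := by
    funext s
    refine eq_false ?_
    rintro ⟨a, ha, b, hb, _, _, hab⟩
    exact h a ha b hb hab
  rw [this, sqfreeIdeal_false]
  exact regLE_bot d

variable [DecidableEq σ]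

/-- When `Ψ` does not depend on `x`, dividing a monomial by `x` does not affect whether its support
satisfies `Ψ`. This supplies the hypothesis of `RegLE.X_mul`. -/
lemma mem_sqfreeIdeal_and_mem_iff {Ψ : Finset σ → Prop} (hΨ : Monotone Ψ) (x : σ)
    (hx : ∀ s, Ψ (insert x s) → Ψ s) (p : MvPolynomial σ K) :
    p ∈ sqfreeIdeal K (fun s => x ∈ s ∧ Ψ s) ↔
      ∃ q ∈ sqfreeIdeal K Ψ, MvPolynomial.X x * q = p := by
  have hmono : Monotone fun s => x ∈ s ∧ Ψ s := fun s t h hs => ⟨h hs.1, hΨ h hs.2⟩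
  have key : ∀ m : σ →₀ ℕ, (Finsupp.single x 1 + m).support = insert x m.support := by
    intro m
    ext y
    by_cases hy : y = x
    · subst hy; simp
    · simp [hy, Finsupp.single_eq_of_ne hy]
  constructor
  · intro hp
    rw [mem_sqfreeIdeal hmono] at hp
    obtain ⟨q, rfl⟩ : MvPolynomial.X x ∣ p := by
      rw [MvPolynomial.X_dvd_iff_modMonomial_eq_zero]
      ext m
      rw [MvPolynomial.coeff_zero]
      by_cases h : Finsupp.single x 1 ≤ m
      · exact MvPolynomial.coeff_modMonomial_of_le _ h
      · rw [MvPolynomial.coeff_modMonomial_of_not_le _ h]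
        by_contra h0
        refine h (Finsupp.single_le_iff.2 (Nat.one_le_iff_ne_zero.2 ?_))
        exact Finsupp.mem_support_iff.1 (hp m (MvPolynomial.mem_support_iff.2 h0)).1
    refine ⟨q, (mem_sqfreeIdeal hΨ).2 fun m hm => hx _ ?_, rfl⟩
    rw [← key]
    refine (hp _ ?_).2
    rw [MvPolynomial.mem_support_iff] at hm ⊢
    rwa [MvPolynomial.coeff_X_mul]
  · rintro ⟨q, hq, rfl⟩
    rw [mem_sqfreeIdeal hΨ] at hq
    rw [mem_sqfreeIdeal hmono]
    intro m hm
    rw [MvPolynomial.support_X_mul, Finset.mem_map] at hm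
    obtain ⟨l, hl, rfl⟩ := hm
    have : (addLeftEmbedding (Finsupp.single x 1) l).support = insert x l.support := key l
    rw [this]
    exact ⟨Finset.mem_insert_self _ _, hΨ (Finset.subset_insert _ _) (hq l hl)⟩

/-- The regularity of a squarefree monomial ideal is bounded through its colon ideal by a variable
and its restriction to the other variables. -/
lemma RegLE.of_insert_of_erase {Φ : Finset σ → Prop} (hΦ : Monotone Φ) (x : σ) {d : ℤ}
    (h1 : RegLE F (sqfreeIdeal K fun s => Φ (insert x s)) d)
    (h0 : RegLE F (sqfreeIdeal K fun s => Φ (s.erase x)) (d + 1)) :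
    RegLE F (sqfreeIdeal K Φ) (d + 1) := by
  have m1 : Monotone fun s : Finset σ => Φ (insert x s) := fun s t h => hΦ (Finset.insert_subset_insert x h)
  have m0 : Monotone fun s : Finset σ => Φ (s.erase x) := fun s t h => hΦ (Finset.erase_subset_erase x h)
  have m2 : Monotone fun s => x ∈ s ∧ Φ (insert x s) := fun s t h hs => ⟨h hs.1, m1 h hs.2⟩
  -- With `Φ (insert x ·)` describing the colon ideal `I : x` and `Φ (·.erase x)` the ideal `I₀`
  -- generated by the monomials of `I` free of `x`, this is `I = x (I : x) + I₀`. The two summands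
  -- meet in `x I₀`, so its bound `d + 2` is just what Mayer-Vietoris needs.
  have hsup : Φ = fun s => (x ∈ s ∧ Φ (insert x s)) ∨ Φ (s.erase x) := by
    funext s
    by_cases hs : x ∈ s
    · simpa [hs] using hΦ (Finset.erase_subset x s)
    · simp [hs]
  have hinf : (fun s => (x ∈ s ∧ Φ (insert x s)) ∧ Φ (s.erase x)) =
      fun s => x ∈ s ∧ Φ (s.erase x) := by
    funext s
    refine propext ⟨fun h => ⟨h.1.1, h.2⟩, fun h => ⟨⟨h.1, hΦ ?_ h.2⟩, h.2⟩⟩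
    exact (Finset.erase_subset _ _).trans (Finset.subset_insert _ _)
  rw [hsup, ← sqfreeIdeal_sup]
  refine RegLE.sup ?_ h0 ?_ (isHomogIdeal_sqfreeIdeal m2) (isHomogIdeal_sqfreeIdeal m0)
  · exact h1.X_mul x (mem_sqfreeIdeal_and_mem_iff m1 x fun s h => by
      rwa [Finset.insert_idem] at h)
  · rw [sqfreeIdeal_inf m2 m0, hinf]
    exact h0.X_mul x (mem_sqfreeIdeal_and_mem_iff m0 x fun s h => by
      rwa [Finset.erase_insert_eq_erase] at h)

/-- Adding new variables to an ideal does not increase its regularity. -/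
lemma RegLE.add_vars {Φ : Finset σ → Prop} (hΦ : Monotone Φ) {d : ℤ} (hd : 1 ≤ d)
    (h : RegLE F (sqfreeIdeal K Φ) d) (N : Finset σ)
    (hN : ∀ y ∈ N, ∀ s, Φ s → Φ (s.erase y)) :
    RegLE F (sqfreeIdeal K fun s => (∃ y ∈ N, y ∈ s) ∨ Φ s) d := by
  induction N using Finset.induction_on with
  | empty => simpa using h
  | insert y N hy ih =>
    have ih := ih fun z hz => hN z (Finset.mem_insert_of_mem hz)
    obtain ⟨e, rfl⟩ : ∃ e, d = e + 1 := ⟨d - 1, by ring⟩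
    -- The colon by `y` is the unit ideal, harmless because `0 ≤ e`; deleting `y` gives back the
    -- ideal of the induction hypothesis.
    refine RegLE.of_insert_of_erase ?_ y ?_ ?_
    · rintro s t hst (⟨z, hz, hzs⟩ | hs)
      exacts [.inl ⟨z, hz, hst hzs⟩, .inr (hΦ hst hs)]
    · have : (fun s => (∃ z ∈ insert y N, z ∈ insert y s) ∨ Φ (insert y s)) = fun _ => True := by
        funext s
        exact eq_true (.inl ⟨y, Finset.mem_insert_self _ _, Finset.mem_insert_self _ _⟩)
      rw [this, sqfreeIdeal_true]
      exact regLE_top.mono (by linarith)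
    · convert ih using 3 with s
      refine ⟨?_, ?_⟩
      · rintro (⟨z, hz, hzs⟩ | hs)
        · rw [Finset.mem_erase] at hzs
          exact .inl ⟨z, Finset.mem_of_mem_insert_of_ne hz hzs.1, hzs.2⟩
        · exact .inr (hΦ (Finset.erase_subset _ _) hs)
      · rintro (⟨z, hz, hzs⟩ | hs)
        · refine .inl ⟨z, Finset.mem_insert_of_mem hz, Finset.mem_erase.2 ⟨?_, hzs⟩⟩
          rintro rfl
          exact hy hz
        · exact .inr (hN y (Finset.mem_insert_self _ _) s hs)

/-! ## Edge ideals of induced subgraphs -/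

open Classical in
/-- Removing a vertex `x`: the regularity is bounded through the deletion of `x` and the deletion
of its closed neighbourhood. -/
lemma RegLE.of_erase_vertex {G : SimpleGraph σ} {W : Finset σ} {x : σ} (hx : x ∉ W) {d : ℤ}
    (hd : 1 ≤ d) (h1 : RegLE F (sqfreeIdeal K (HasEdgeIn G (W.filter fun y => ¬ G.Adj x y))) d)
    (h0 : RegLE F (sqfreeIdeal K (HasEdgeIn G W)) (d + 1)) :
    RegLE F (sqfreeIdeal K (HasEdgeIn G (insert x W))) (d + 1) := by
  refine RegLE.of_insert_of_erase (hasEdgeIn_mono G _) x ?_ ?_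
  -- The colon by `x` is generated by the neighbours of `x`, as variables, and the edges among its
  -- non-neighbours: any other edge avoiding `x` contains a neighbour and is redundant.
  · convert h1.add_vars (hasEdgeIn_mono G _) hd (W.filter fun y => G.Adj x y) ?_ using 3 with s
    · refine ⟨?_, ?_⟩
      · have aux : ∀ a b, a ∈ W → b ∈ insert x W → a ∈ s → b ∈ insert x s → G.Adj a b →
            (∃ y ∈ W.filter (fun y => G.Adj x y), y ∈ s) ∨
              (b ∈ W ∧ b ∈ s ∧ ¬ G.Adj x a) := by
          intro a b ha hb has hbs hab
          by_cases hxa : G.Adj x a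
          · exact .inl ⟨a, Finset.mem_filter.2 ⟨ha, hxa⟩, has⟩
          · have hbx : b ≠ x := by
              rintro rfl
              exact hxa hab.symm
            exact .inr ⟨Finset.mem_of_mem_insert_of_ne hb hbx,
              Finset.mem_of_mem_insert_of_ne hbs hbx, hxa⟩
        rintro ⟨a, ha, b, hb, has, hbs, hab⟩
        by_cases hax : a = x
        · subst hax
          have hba : b ≠ a := hab.ne'
          exact .inl ⟨b, Finset.mem_filter.2 ⟨Finset.mem_of_mem_insert_of_ne hb hba, hab⟩,
            Finset.mem_of_mem_insert_of_ne hbs hba⟩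
        · have ha' := Finset.mem_of_mem_insert_of_ne ha hax
          have has' := Finset.mem_of_mem_insert_of_ne has hax
          obtain h | ⟨hbW, hb', hxa⟩ := aux a b ha' hb has' hbs hab
          · exact .inl h
          obtain h | ⟨-, -, hxb⟩ := aux b a hbW ha hb' has hab.symm
          · exact .inl h
          exact .inr ⟨a, Finset.mem_filter.2 ⟨ha', hxa⟩, b, Finset.mem_filter.2 ⟨hbW, hxb⟩,
            has', hb', hab⟩
      · rintro (⟨y, hy, hys⟩ | ⟨a, ha, b, hb, has, hbs, hab⟩)
        · rw [Finset.mem_filter] at hy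
          exact ⟨x, Finset.mem_insert_self _ _, y, Finset.mem_insert_of_mem hy.1,
            Finset.mem_insert_self _ _, Finset.mem_insert_of_mem hys, hy.2⟩
        · rw [Finset.mem_filter] at ha hb
          exact ⟨a, Finset.mem_insert_of_mem ha.1, b, Finset.mem_insert_of_mem hb.1,
            Finset.mem_insert_of_mem has, Finset.mem_insert_of_mem hbs, hab⟩
    · rintro y hy s ⟨a, ha, b, hb, has, hbs, hab⟩
      rw [Finset.mem_filter] at hy
      refine ⟨a, ha, b, hb, Finset.mem_erase.2 ⟨?_, has⟩, Finset.mem_erase.2 ⟨?_, hbs⟩, hab⟩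
      · rintro rfl
        exact (Finset.mem_filter.1 ha).2 hy.2
      · rintro rfl
        exact (Finset.mem_filter.1 hb).2 hy.2
  · convert h0 using 3 with s
    refine ⟨?_, ?_⟩
    · rintro ⟨a, ha, b, hb, has, hbs, hab⟩
      rw [Finset.mem_erase] at has hbs
      exact ⟨a, Finset.mem_of_mem_insert_of_ne ha has.1, b,
        Finset.mem_of_mem_insert_of_ne hb hbs.1, has.2, hbs.2, hab⟩
    · rintro ⟨a, ha, b, hb, has, hbs, hab⟩
      refine ⟨a, Finset.mem_insert_of_mem ha, b, Finset.mem_insert_of_mem hb,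
        Finset.mem_erase.2 ⟨?_, has⟩, Finset.mem_erase.2 ⟨?_, hbs⟩, hab⟩
      · rintro rfl
        exact hx ha
      · rintro rfl
        exact hx hb

open Classical in
/-- Removing the vertices in the order of decreasing rank, the regularity is bounded through the
subgraphs on the non-neighbours of smaller rank. -/
lemma RegLE.of_rank {G : SimpleGraph σ} {W : Finset σ} (ρ : σ → ℕ) (hρ : Set.InjOn ρ W) {d : ℤ}
    (hd : 1 ≤ d) (h : ∀ x ∈ W, RegLE F (sqfreeIdeal K
      (HasEdgeIn G (W.filter fun y => ρ y < ρ x ∧ ¬ G.Adj x y))) d) :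
    RegLE F (sqfreeIdeal K (HasEdgeIn G W)) (d + 1) := by
  induction W using Finset.induction_on_max_value ρ with
  | empty => exact regLE_of_forall_not_adj (by simp) _
  | insert x W hx hmax ih =>
    refine RegLE.of_erase_vertex hx hd ?_ (ih ?_ fun y hy => ?_)
    · convert h x (Finset.mem_insert_self _ _) using 3
      ext y
      simp only [Finset.mem_filter, Finset.mem_insert]
      refine ⟨fun hy => ⟨.inr hy.1, lt_of_le_of_ne (hmax y hy.1) fun he => ?_, hy.2⟩, ?_⟩
      · have := hρ (Finset.mem_insert_of_mem hy.1) (Finset.mem_insert_self x W) he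
        exact hx (this ▸ hy.1)
      · rintro ⟨rfl | hy, hlt, hn⟩
        exacts [absurd hlt (lt_irrefl _), ⟨hy, hn⟩]
    · exact hρ.mono (by simp)
    · convert h y (Finset.mem_insert_of_mem hy) using 3
      ext z
      simp only [Finset.mem_filter, Finset.mem_insert]
      refine ⟨fun hz => ⟨.inr hz.1, hz.2⟩, ?_⟩
      rintro ⟨rfl | hz, hlt, hn⟩
      exacts [absurd hlt (hmax y hy).not_gt, ⟨hz, hlt, hn⟩]

end Squarefree

/-! ## The regularity of staircase graphs -/

section Staircase

variable {K : Type u} [Field K] {σ : Type v} [Fintype σ] {F : GradedFreeResolution K σ}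

/-- Two vertices at positions `i < j` in `{1, …, n}` are adjacent if `i - 1`, `j - i - 1` and
`n - j` are at least `a`, `b` and `c` for a triple `(a, b, c)` in a set `T` of triples with sum
`r - 2`. If `n ≥ 4 * r`, the regularity of the edge ideal of this graph is at most `3`. -/
lemma regLE_three_of_staircase {T : ℕ → ℕ → ℕ → Prop} {r n : ℕ}
    (hT : ∀ a b c, T a b c → a + b + c + 2 = r) (hn : 4 * r ≤ n) (pos : σ → ℕ)
    (hpos : Function.Injective pos) (hle : ∀ v, pos v ≤ n) {G : SimpleGraph σ}
    (hG : ∀ v w, pos v < pos w →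
      (G.Adj v w ↔ ∃ a b c, T a b c ∧ a < pos v ∧ pos v + b < pos w ∧ pos w + c ≤ n)) :
    RegLE F (sqfreeIdeal K (HasEdgeIn G Finset.univ)) 3 := by
  classical
  have hadj : ∀ v w, pos v < pos w → ¬ G.Adj v w → ∀ a b c, T a b c → a < pos v →
      pos v + b < pos w → pos w + c ≤ n → False := fun v w hvw h a b c ht h1 h2 h3 =>
    h ((hG v w hvw).2 ⟨a, b, c, ht, h1, h2, h3⟩)
  -- Up to position `2r` the condition on `c` is automatic, so moving the right end of an edge to
  -- the right keeps it an edge.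
  have hleft : ∀ u v w, pos u < pos v → pos v < pos w → pos w ≤ 2 * r → ¬ G.Adj u w →
      ¬ G.Adj u v := by
    intro u v w huv hvw hw h h'
    obtain ⟨a, b, c, ht, h1, h2, h3⟩ := (hG u v huv).1 h'
    have := hT a b c ht
    exact hadj u w (by omega) h a b c ht h1 (by omega) (by omega)
  -- Beyond position `r` the condition on `a` is automatic, so the left end may move to the left.
  have hright : ∀ u v w, r < pos u → pos u < pos v → pos v < pos w → ¬ G.Adj u w →
      ¬ G.Adj v w := by
    intro u v w hu huv hvw h h'
    obtain ⟨a, b, c, ht, h1, h2, h3⟩ := (hG v w hvw).1 h'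
    have := hT a b c ht
    exact hadj u w (by omega) h a b c ht (by omega) (by omega) (by omega)
  -- Between the blocks `≤ r` and `> 2r` the condition on `b` is automatic, so the left end may move
  -- to the right within its block.
  have hcross : ∀ u v w, pos u < pos v → pos v ≤ r → 2 * r < pos w → ¬ G.Adj v w →
      ¬ G.Adj u w := by
    intro u v w huv hv hw h h'
    obtain ⟨a, b, c, ht, h1, h2, h3⟩ := (hG u w (by omega)).1 h'
    have := hT a b c ht
    exact hadj v w (by omega) h a b c ht (by omega) (by omega) (by omega)
  -- Vertices outside `W` are isolated. Membership in `W` provides the triples from which `hgap`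
  -- builds edges.
  let W : Finset σ := Finset.univ.filter fun v =>
    (∃ a b c, T a b c ∧ a < pos v) ∧ ∃ a b c, T a b c ∧ pos v + c ≤ n
  have hW : HasEdgeIn G Finset.univ = HasEdgeIn G W := by
    have aux : ∀ v w, G.Adj v w → v ∈ W := by
      intro v w hvw
      have hne : pos v ≠ pos w := fun h => hvw.ne (hpos h)
      refine Finset.mem_filter.2 ⟨Finset.mem_univ _, ?_⟩
      obtain h | h := lt_or_gt_of_ne hne
      · obtain ⟨a, b, c, ht, h1, h2, h3⟩ := (hG v w h).1 hvw
        exact ⟨⟨a, b, c, ht, h1⟩, ⟨a, b, c, ht, by omega⟩⟩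
      · obtain ⟨a, b, c, ht, h1, h2, h3⟩ := (hG w v h).1 hvw.symm
        exact ⟨⟨a, b, c, ht, by omega⟩, ⟨a, b, c, ht, by omega⟩⟩
    funext s
    refine propext ⟨?_, ?_⟩
    · rintro ⟨a, -, b, -, ha, hb, hab⟩
      exact ⟨a, aux a b hab, b, aux b a hab.symm, ha, hb, hab⟩
    · rintro ⟨a, -, b, -, ha, hb, hab⟩
      exact ⟨a, Finset.mem_univ _, b, Finset.mem_univ _, ha, hb, hab⟩
  rw [hW]
  change RegLE F _ (2 + 1)
  -- First round: positions are removed in the order `r, …, 1`, then `r + 1, …, n`.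
  refine RegLE.of_rank (fun v => if pos v ≤ r then n + pos v else n - pos v) ?_ (by norm_num) ?_
  · intro v _ w _ h
    have h1 := hle v
    have h2 := hle w
    refine hpos ?_
    dsimp only at h
    split_ifs at h <;> omega
  intro x hxW
  obtain ⟨⟨a₀, b₀, c₀, ht₀, hx₀⟩, -⟩ := (Finset.mem_filter.1 hxW).2
  have hs₀ := hT _ _ _ ht₀
  by_cases hx : pos x ≤ r
  · rw [if_pos hx]
    change RegLE F _ (1 + 1)
    -- Second round, among the non-neighbours of `x` to the left of `x` or beyond `r`: the order is
    -- `2r, …, r + 1`, then `2r + 1, …, n`, then the left block downwards.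
    refine RegLE.of_rank (fun v => if pos v ≤ r then pos v else
      if pos v ≤ 2 * r then 2 * n + pos v else 2 * n - pos v) ?_ le_rfl ?_
    · intro v _ w _ h
      have h1 := hle v
      have h2 := hle w
      refine hpos ?_
      dsimp only at h
      split_ifs at h <;> omega
    intro z hz
    refine regLE_of_forall_not_adj ?_ _
    suffices h : ∀ v w, v ∈ W → w ∈ W → pos v < pos w →
        (if pos v ≤ r then n + pos v else n - pos v) < n + pos x →
        (if pos w ≤ r then n + pos w else n - pos w) < n + pos x →
        ¬ G.Adj x v → ¬ G.Adj x w → _ → _ → ¬ G.Adj z v → ¬ G.Adj z w → ¬ G.Adj v w by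
      intro v hv w hw hvw
      simp only [Finset.mem_filter] at hv hw
      have hne : pos v ≠ pos w := fun h => hvw.ne (hpos h)
      obtain hlt | hlt := lt_or_gt_of_ne hne
      · exact h v w hv.1.1 hw.1.1 hlt hv.1.2.1 hw.1.2.1 hv.1.2.2 hw.1.2.2 hv.2.1 hw.2.1 hv.2.2
          hw.2.2 hvw
      · exact h w v hw.1.1 hv.1.1 hlt hw.1.2.1 hv.1.2.1 hw.1.2.2 hv.1.2.2 hw.2.1 hv.2.1 hw.2.2
          hv.2.2 hvw.symm
    intro v w hvW hwW hvw hv1 hw1 hv2 hw2 hv3 hw3 hv4 hw4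
    simp only [Finset.mem_filter] at hz
    obtain ⟨hzW, hz1, hz2⟩ := hz
    have hvn := hle v
    have hwn := hle w
    have hzn := hle z
    -- If the triple of `t` failed on `b`, then `pos t < 3r`, and the triple of `x` would make `x`
    -- and `t` adjacent: its `c₀` is below `r`, so `pos t + c₀ ≤ 4r ≤ n`.
    have hgap : ∀ u t, t ∈ W → r < pos u → pos u ≤ 2 * r → 2 * r < pos t → ¬ G.Adj x t →
        G.Adj u t := by
      intro u t htW hu hu' ht hxt
      obtain ⟨a, b, c, habc, h1⟩ := (Finset.mem_filter.1 htW).2.2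
      have := hT _ _ _ habc
      refine (hG u t (by omega)).2 ⟨a, b, c, habc, by omega, ?_, h1⟩
      by_contra hlt
      exact hadj x t (by omega) hxt a₀ b₀ c₀ ht₀ hx₀ (by omega) (by omega)
    by_cases hwr : pos w ≤ r
    · rw [if_pos hwr] at hw1
      rw [SimpleGraph.adj_comm] at hv2
      exact hleft v w x hvw (by omega) (by omega) hv2
    rw [if_neg hwr] at hw1 hw3
    by_cases hzr : pos z ≤ r
    · rw [if_pos hzr] at hw3
      split_ifs at hw3 <;> omega
    rw [if_neg hzr] at hv3 hw3
    by_cases hz2r : pos z ≤ 2 * r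
    · rw [if_pos hz2r] at hv3 hw3
      have hw2r : pos w ≤ 2 * r := by
        by_contra hlt
        exact hw4 (hgap z w hwW (by omega) hz2r (by omega) hw2)
      rw [if_pos hw2r] at hw3
      rw [SimpleGraph.adj_comm] at hv4
      exact hleft v w z hvw (by omega) hz2r hv4
    · rw [if_neg hz2r] at hv3 hw3
      have hw2r : ¬ pos w ≤ 2 * r := fun hlt => by
        rw [if_pos hlt] at hw3
        omega
      rw [if_neg hw2r] at hw3
      -- Here `w` lies beyond `2r`. A `v` in the left block is compared with `x`, which lies to its
      -- right; any other `v` lies beyond `z` and is compared with `z`.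
      by_cases hvr : pos v ≤ r
      · rw [if_pos hvr] at hv1
        exact hcross v x w (by omega) hx (by omega) hw2
      · rw [if_neg hvr] at hv3
        have hv2r : ¬ pos v ≤ 2 * r := fun hlt => by
          rw [if_pos hlt] at hv3
          omega
        rw [if_neg hv2r] at hv3
        exact hright z v w (by omega) (by omega) hvw hw4
  · rw [if_neg hx]
    -- The left block is gone, so only vertices to the right of `x` remain, and `hright` applies.
    refine regLE_of_forall_not_adj ?_ _
    have aux : ∀ v ∈ W, (if pos v ≤ r then n + pos v else n - pos v) < n - pos x →
        pos x < pos v := by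
      intro v _ h
      have := hle v
      split_ifs at h <;> omega
    intro v hv w hw hvw
    rw [Finset.mem_filter] at hv hw
    have hv1 := aux v hv.1 hv.2.1
    have hw1 := aux w hw.1 hw.2.1
    have hne : pos v ≠ pos w := fun h => hvw.ne (hpos h)
    obtain h | h := lt_or_gt_of_ne hne
    · exact hright x v w (by omega) hv1 h hw.2.2 hvw
    · exact hright x w v (by omega) hw1 h hv.2.2 hvw.symm

end Staircase

/-! ## Edge ideals and increasing maps -/

section Chain

variable {K : Type u} [Field K]

lemma support_X_mul_X {σ : Type v} [DecidableEq σ] (a b : σ) :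
    (Finsupp.single a 1 + Finsupp.single b 1 : σ →₀ ℕ).support = {a, b} := by
  ext c
  by_cases ha : c = a <;> by_cases hb : c = b <;> simp [Finsupp.single_apply, ha, hb, eq_comm]

lemma X_mul_X_eq_monomial {σ : Type v} (a b : σ) :
    (MvPolynomial.X a * MvPolynomial.X b : MvPolynomial σ K) =
      MvPolynomial.monomial (Finsupp.single a 1 + Finsupp.single b 1) 1 := by
  simp [MvPolynomial.X, MvPolynomial.monomial_mul]

lemma edgeIdeal_eq_sqfreeIdeal {σ : Type v} [Fintype σ] (G : SimpleGraph σ) :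
    edgeIdeal K G = sqfreeIdeal K (HasEdgeIn G Finset.univ) := by
  classical
  apply le_antisymm
  · refine Ideal.span_le.2 ?_
    rintro _ ⟨a, b, hab, rfl⟩
    rw [X_mul_X_eq_monomial]
    refine Ideal.subset_span ⟨_, ?_, rfl⟩
    change HasEdgeIn G _ _
    rw [support_X_mul_X]
    exact ⟨a, Finset.mem_univ _, b, Finset.mem_univ _, by simp, by simp, hab⟩
  · refine Ideal.span_le.2 ?_
    rintro _ ⟨m, ⟨a, -, b, -, ha, hb, hab⟩, rfl⟩
    have h : Finsupp.single a 1 + Finsupp.single b 1 ≤ m := by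
      intro c
      rw [Finsupp.mem_support_iff] at ha hb
      have := hab.ne
      simp only [Finsupp.add_apply, Finsupp.single_apply]
      split_ifs with h1 h2 h2
      · exact absurd (h1.trans h2.symm) this
      · subst h1; omega
      · subst h2; omega
      · omega
    refine Ideal.mem_of_dvd _ ?_ (Ideal.subset_span ⟨a, b, hab, rfl⟩)
    rw [X_mul_X_eq_monomial]
    exact MvPolynomial.monomial_dvd_monomial.2 ⟨.inr h, dvd_rfl⟩

/-- An edge ideal determines its graph, so inclusions of ideals become inclusions of edge sets. -/
lemma X_mul_X_mem_edgeIdeal {σ : Type v} [Fintype σ] {G : SimpleGraph σ} {a b : σ} :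
    (MvPolynomial.X a * MvPolynomial.X b : MvPolynomial σ K) ∈ edgeIdeal K G ↔ G.Adj a b := by
  classical
  refine ⟨fun h => ?_, fun h => Ideal.subset_span ⟨a, b, h, rfl⟩⟩
  rw [edgeIdeal_eq_sqfreeIdeal, mem_sqfreeIdeal (hasEdgeIn_mono _ _), X_mul_X_eq_monomial] at h
  obtain ⟨c, -, d, -, hc, hd, hcd⟩ := h (Finsupp.single a 1 + Finsupp.single b 1) (by
    rw [MvPolynomial.mem_support_iff, MvPolynomial.coeff_monomial, if_pos rfl]
    exact one_ne_zero)
  rw [support_X_mul_X] at hc hd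
  simp only [Finset.mem_insert, Finset.mem_singleton] at hc hd
  obtain rfl | rfl := hc <;> obtain rfl | rfl := hd
  exacts [absurd hcd (G.irrefl), hcd, hcd.symm, absurd hcd (G.irrefl)]

/-! ### Images of edges under strictly increasing maps -/

/-- Each step raises `π` by at least one, so `π k - k` is nondecreasing in `k`; the additive form
avoids truncated subtraction. -/
lemma Inc.add_le_add (π : Inc) {k l : ℕ+} (h : k ≤ l) : (π k : ℕ) + l ≤ π l + k := by
  induction l using PNat.recOn with
  | one =>
    obtain rfl : k = 1 := le_antisymm h one_le
    exact le_rfl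
  | succ l ih =>
    obtain rfl | h := h.eq_or_lt
    · exact le_rfl
    · have h1 := ih (PNat.lt_add_one_iff.1 h)
      have h2 : π l < π (l + 1) := π.strictMono (PNat.lt_add_right l 1)
      rw [← PNat.coe_lt_coe] at h2
      rw [PNat.add_coe, PNat.one_coe]
      omega

lemma Inc.le_apply (π : Inc) (k : ℕ+) : k ≤ π k :=
  π.strictMono.le_apply

/-- The hypotheses say that none of the three gaps shrinks. The map is the identity below `a`, the
shift by `i - a` on `[a, b)`, and the shift by `j - b` from `b` on. -/
lemma exists_inc {a b m i j n : ℕ+} (hab : a < b) (hbm : b ≤ m) (hai : a ≤ i)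
    (hij : (i : ℕ) + b ≤ j + a) (hjn : (j : ℕ) + m ≤ n + b) :
    ∃ π : Inc, π a = i ∧ π b = j ∧ π m ≤ n := by
  rw [← PNat.coe_lt_coe] at hab
  rw [← PNat.coe_le_coe] at hai hbm
  have hpos : ∀ k : ℕ+, 0 < (if (k : ℕ) < a then (k : ℕ) else
      if (k : ℕ) < b then (k : ℕ) + (i - a) else (k : ℕ) + (j - b)) := by
    intro k
    have := k.pos
    split_ifs <;> omega
  obtain ⟨f, hf⟩ : ∃ f : ℕ+ → ℕ+, ∀ k, (f k : ℕ) = if (k : ℕ) < a then (k : ℕ) else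
      if (k : ℕ) < b then (k : ℕ) + (i - a) else (k : ℕ) + (j - b) :=
    ⟨fun k => ⟨_, hpos k⟩, fun _ => rfl⟩
  have hmono : StrictMono f := by
    intro k l hkl
    rw [← PNat.coe_lt_coe] at hkl ⊢
    rw [hf, hf]
    split_ifs <;> omega
  have h1 := hf a
  have h2 := hf b
  have h3 := hf m
  refine ⟨OrderEmbedding.ofStrictMono f hmono, PNat.coe_injective ?_, PNat.coe_injective ?_,
    PNat.coe_le_coe _ _ |>.1 ?_⟩
  · change (f a : ℕ) = i
    split_ifs at h1 <;> omega
  · change (f b : ℕ) = j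
    split_ifs at h2 <;> omega
  · change (f m : ℕ) ≤ n
    split_ifs at h3 <;> omega

/-- The edge `{v, w}`, with `v < w ≤ n`, is the image of an edge of the graph `G` on `{1, …, m}`
under a strictly increasing map `π` with `π m ≤ n`. -/
def OrbitRel {m : ℕ+} (G : SimpleGraph (Set.Iic m)) (n : ℕ+) (v w : Set.Iic n) : Prop :=
  ∃ a b : Set.Iic m, G.Adj a b ∧ (a : ℕ+) < b ∧ (a : ℕ+) ≤ v ∧
    ((v : ℕ+) : ℕ) + (b : ℕ+) ≤ (w : ℕ+) + (a : ℕ+) ∧ ((w : ℕ+) : ℕ) + m ≤ n + (b : ℕ+)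

lemma OrbitRel.lt {m : ℕ+} {G : SimpleGraph (Set.Iic m)} {n : ℕ+} {v w : Set.Iic n}
    (h : OrbitRel G n v w) : v < w := by
  obtain ⟨a, b, -, h1, -, h2, -⟩ := h
  rw [← PNat.coe_lt_coe] at h1
  rw [← Subtype.coe_lt_coe, ← PNat.coe_lt_coe]
  omega

/-- The graph on `{1, …, n}` consisting of the images of the edges of the graph `G` on
`{1, …, m}` under strictly increasing maps `π` with `π m ≤ n`. -/
def orbitGraph {m : ℕ+} (G : SimpleGraph (Set.Iic m)) (n : ℕ+) : SimpleGraph (Set.Iic n) where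
  Adj v w := OrbitRel G n v w ∨ OrbitRel G n w v
  symm := ⟨fun _ _ h => h.symm⟩
  loopless := ⟨fun _ h => h.elim (fun h => h.lt.false) fun h => h.lt.false⟩

lemma orbitGraph_adj_of_lt {m : ℕ+} {G : SimpleGraph (Set.Iic m)} {n : ℕ+} {v w : Set.Iic n}
    (h : v < w) : (orbitGraph G n).Adj v w ↔ OrbitRel G n v w :=
  or_iff_left fun h' => h.asymm h'.lt

lemma orbitIdeal_edgeIdeal {m : ℕ+} (G : SimpleGraph (Set.Iic m)) (n : ℕ+) :
    orbitIdeal (edgeIdeal K G) n = edgeIdeal K (orbitGraph G n) := by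
  apply le_antisymm
  · refine Ideal.span_le.2 ?_
    rintro _ ⟨π, h, f, hf, rfl⟩
    suffices hle : edgeIdeal K G ≤ (edgeIdeal K (orbitGraph G n)).comap (incMap K π h) from hle hf
    refine Ideal.span_le.2 ?_
    have key : ∀ a b : Set.Iic m, a < b → G.Adj a b →
        OrbitRel G n ⟨π a, (π.monotone a.2).trans h⟩ ⟨π b, (π.monotone b.2).trans h⟩ := by
      intro a b hlt hab
      refine ⟨a, b, hab, hlt, Inc.le_apply π a, Inc.add_le_add π hlt.le, ?_⟩
      have h1 := Inc.add_le_add π b.2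
      rw [← PNat.coe_le_coe] at h
      exact h1.trans (by omega)
    rintro _ ⟨a, b, hab, rfl⟩
    rw [SetLike.mem_coe, Ideal.mem_comap, map_mul, incMap, MvPolynomial.rename_X,
      MvPolynomial.rename_X]
    refine Ideal.subset_span ⟨_, _, ?_, rfl⟩
    obtain hlt | hlt := lt_or_gt_of_ne hab.ne
    · exact .inl (key a b hlt hab)
    · exact .inr (key b a hlt hab.symm)
  · refine Ideal.span_le.2 ?_
    have key : ∀ v w, OrbitRel G n v w →
        (MvPolynomial.X v * MvPolynomial.X w : PolyRing K n) ∈ orbitIdeal (edgeIdeal K G) n := by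
      rintro v w ⟨a, b, hab, h1, h2, h3, h4⟩
      obtain ⟨π, ha, hb, hm⟩ := exists_inc h1 b.2 h2 h3 h4
      refine Ideal.subset_span ⟨π, hm, _, Ideal.subset_span ⟨a, b, hab, rfl⟩, ?_⟩
      rw [map_mul, incMap, MvPolynomial.rename_X, MvPolynomial.rename_X]
      congr 2 <;> exact Subtype.ext (by assumption)
    rintro _ ⟨v, w, h | h, rfl⟩
    · exact key v w h
    · rw [mul_comm]
      exact key w v h

/-! ### Stabilization of the chain -/

lemma orbitIdeal_le {I : ∀ n : ℕ+, Ideal (PolyRing K n)} (hI : IsIncInvariantChain I) {m n : ℕ+}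
    (hmn : m ≤ n) : orbitIdeal (I m) n ≤ I n := by
  refine Ideal.span_le.2 ?_
  rintro _ ⟨π, h, f, hf, rfl⟩
  obtain rfl | hlt := hmn.eq_or_lt
  -- Invariance is only assumed for `m < n`; at `m = n`, the bound `π m ≤ m` forces `π` to fix every
  -- `k ≤ m`.
  · have hid : incMap K π h = AlgHom.id K _ := by
      rw [incMap, ← MvPolynomial.rename_id]
      congr 1
      funext k
      refine Subtype.ext ?_
      have h1 := Inc.add_le_add π k.2
      have h2 := Inc.le_apply π k
      rw [← PNat.coe_le_coe] at h h2
      rw [← PNat.coe_inj]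
      change (π k : ℕ) = _
      simp only [id]
      omega
    rw [hid]
    exact hf
  · exact hI m n hlt π h f hf

/-- Dickson's lemma, for triples. -/
lemma exists_bound_of_triples (T : Set (ℕ × ℕ × ℕ)) :
    ∃ N : ℕ, ∀ t ∈ T, ∃ s ∈ T, s ≤ t ∧ s.1 + s.2.1 + s.2.2 ≤ N := by
  -- Minimal elements form an antichain, and antichains in `ℕ³` are finite.
  have hfin : {s | Minimal (· ∈ T) s}.Finite :=
    (setOfPred_minimal_antichain _).finite_of_partiallyWellOrderedOn (Set.isPWO_of_wellQuasiOrderedLE _)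
  obtain ⟨N, hN⟩ := (hfin.image fun s => s.1 + s.2.1 + s.2.2).bddAbove
  refine ⟨N, fun t ht => ?_⟩
  obtain ⟨s, hst, hs⟩ := exists_minimal_le_of_wellFoundedLT (· ∈ T) t ht
  exact ⟨s, hs.prop, hst, hN ⟨s, hs, rfl⟩⟩

/-- A chain of edge ideals stabilizes. -/
lemma exists_stabilizesAt {I : ∀ n : ℕ+, Ideal (PolyRing K n)} (hI : IsIncInvariantChain I)
    (hedge : ∀ n : ℕ+, IsEdgeIdeal (I n)) : ∃ r, StabilizesAt I r := by
  choose G hG using hedge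
  have hup : ∀ {m n : ℕ+}, m ≤ n → ∀ {v w : Set.Iic n}, OrbitRel (G m) n v w → (G n).Adj v w := by
    intro m n hmn v w h
    refine X_mul_X_mem_edgeIdeal (K := K).1 ?_
    rw [← hG]
    refine orbitIdeal_le hI hmn ?_
    rw [hG m, orbitIdeal_edgeIdeal]
    exact X_mul_X_mem_edgeIdeal.2 (.inl h)
  let T : Set (ℕ × ℕ × ℕ) := {t | ∃ (n : ℕ+) (v w : Set.Iic n), (G n).Adj v w ∧
    ((v : ℕ+) : ℕ) = t.1 + 1 ∧ ((w : ℕ+) : ℕ) = t.1 + t.2.1 + 2 ∧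
    (n : ℕ) = t.1 + t.2.1 + t.2.2 + 2}
  obtain ⟨N, hN⟩ := exists_bound_of_triples T
  -- An edge with gaps of sum `N` lives at level `N + 2`.
  let R : ℕ+ := ⟨N + 2, by omega⟩
  refine ⟨R, fun n hn => le_antisymm ?_ (orbitIdeal_le hI hn)⟩
  rw [hG n, hG R, orbitIdeal_edgeIdeal]
  have key : ∀ v w, v < w → (G n).Adj v w → OrbitRel (G R) n v w := by
    intro v w hlt hvw
    have hwn : ((w : ℕ+) : ℕ) ≤ n := w.2
    have hv0 := (v : ℕ+).pos
    rw [← Subtype.coe_lt_coe, ← PNat.coe_lt_coe] at hlt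
    rw [← PNat.coe_le_coe] at hn
    change N + 2 ≤ (n : ℕ) at hn
    obtain ⟨⟨a, b, c⟩, ⟨m, v₀, w₀, hadj, hv₀, hw₀, hm⟩, ⟨h1, h2, h3⟩, hs⟩ :=
      hN ((v : ℕ+) - 1, (w : ℕ+) - (v : ℕ+) - 1, n - (w : ℕ+))
        ⟨n, v, w, hvw, by dsimp only; omega, by dsimp only; omega, by dsimp only; omega⟩
    dsimp only at hv₀ hw₀ hm h1 h2 h3 hs
    -- A triple of sum exactly `N` is interpolated between a small gap triple and that of `(v, w)`,
    -- by filling the first gap, then the second, then the third. It gives an edge at level `R` that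
    -- maps to `(v, w)`.
    obtain ⟨a', b', c', ha, hb, hc, ha', hb', hc', hsum⟩ : ∃ a' b' c' : ℕ, a ≤ a' ∧ b ≤ b' ∧
        c ≤ c' ∧ a' < (v : ℕ+) ∧ (v : ℕ+) + b' < (w : ℕ+) ∧ (w : ℕ+) + c' ≤ n ∧
        a' + b' + c' = N := by
      refine ⟨a + min (N - (a + b + c)) ((v : ℕ+) - 1 - a),
        b + min (N - (a + b + c) - ((v : ℕ+) - 1 - a)) ((w : ℕ+) - (v : ℕ+) - 1 - b),
        c + (N - (a + b + c) - ((v : ℕ+) - 1 - a) - ((w : ℕ+) - (v : ℕ+) - 1 - b)), ?_⟩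
      omega
    let v' : Set.Iic R := ⟨⟨a' + 1, by omega⟩, by
      change a' + 1 ≤ N + 2
      omega⟩
    let w' : Set.Iic R := ⟨⟨a' + b' + 2, by omega⟩, by
      change a' + b' + 2 ≤ N + 2
      omega⟩
    have hv' : ((v' : ℕ+) : ℕ) = a' + 1 := rfl
    have hw' : ((w' : ℕ+) : ℕ) = a' + b' + 2 := rfl
    have hR : (R : ℕ) = N + 2 := rfl
    refine ⟨v', w', hup (m := m) ?_ ⟨v₀, w₀, hadj, ?_, ?_, ?_, ?_⟩, ?_, ?_, ?_, ?_⟩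
    all_goals
      first | rw [← PNat.coe_le_coe] | rw [← PNat.coe_lt_coe] | skip
      omega
  refine Ideal.span_le.2 ?_
  rintro _ ⟨v, w, hvw, rfl⟩
  refine X_mul_X_mem_edgeIdeal.2 ?_
  obtain hlt | hlt := lt_or_gt_of_ne hvw.ne
  · exact .inl (key v w hlt hvw)
  · exact .inr (key w v hlt hvw.symm)

lemma regLE_three_orbitGraph {r n : ℕ+} (G : SimpleGraph (Set.Iic r)) (hn : 4 * r ≤ n)
    {F : GradedFreeResolution K (Set.Iic n)} : RegLE F (edgeIdeal K (orbitGraph G n)) 3 := by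
  rw [edgeIdeal_eq_sqfreeIdeal]
  refine regLE_three_of_staircase (r := r) (n := n)
    (T := fun a b c => ∃ v w : Set.Iic r, G.Adj v w ∧ ((v : ℕ+) : ℕ) = a + 1 ∧
      ((w : ℕ+) : ℕ) = a + b + 2 ∧ (r : ℕ) = a + b + c + 2) ?_ ?_ (fun v : Set.Iic n => ((v : ℕ+) : ℕ))
    (PNat.coe_injective.comp Subtype.coe_injective) (fun v => v.2) ?_
  · rintro a b c ⟨v, w, -, -, -, h⟩
    exact h.symm
  · rw [← PNat.coe_le_coe] at hn
    exact hn
  · intro v w hvw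
    rw [orbitGraph_adj_of_lt hvw]
    constructor
    · rintro ⟨a, b, hab, h1, h2, h3, h4⟩
      have hbr : ((b : ℕ+) : ℕ) ≤ r := b.2
      have ha := (a : ℕ+).pos
      rw [← PNat.coe_lt_coe] at h1
      rw [← PNat.coe_le_coe] at h2
      exact ⟨(a : ℕ+) - 1, (b : ℕ+) - (a : ℕ+) - 1, r - (b : ℕ+),
        ⟨a, b, hab, by omega, by omega, by omega⟩, by omega, by omega, by omega⟩
    · rintro ⟨a, b, c, ⟨v', w', hab, hv', hw', hr⟩, h1, h2, h3⟩
      refine ⟨v', w', hab, ?_, ?_, ?_, ?_⟩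
      all_goals
        first | rw [← PNat.coe_le_coe] | rw [← PNat.coe_lt_coe] | skip
        omega

end Chain

end IncChain

end

theorem theorem6p1 {K : Type*} [Field K]
    (I : ∀ n : ℕ+, Ideal (IncChain.PolyRing K n))
    (hI : IncChain.IsIncInvariantChain I)
    (hedge : ∀ n : ℕ+, IncChain.IsEdgeIdeal (I n))
    (hne : ∀ᶠ n in Filter.atTop, I n ≠ ⊥) :
    ∃ r : ℕ+, IncChain.IsStabilityIndex I r ∧
      ∀ n : ℕ+, 4 * r ≤ n → IncChain.idealReg (I n) ≤ 3 := by
  have hstab : {s | IncChain.StabilizesAt I s}.Nonempty := IncChain.exists_stabilizesAt hI hedge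
  obtain ⟨r, hr⟩ : ∃ r, IncChain.IsStabilityIndex I r :=
    ⟨_, WellFounded.min_mem wellFounded_lt _ hstab,
      fun _ hs => not_lt.1 (WellFounded.not_lt_min wellFounded_lt _ hs)⟩
  refine ⟨r, hr, fun n hn => ?_⟩
  have hrn : r ≤ n := by
    rw [← PNat.coe_le_coe, PNat.mul_coe] at hn
    rw [← PNat.coe_le_coe]
    change 4 * (r : ℕ) ≤ n at hn
    omega
  obtain ⟨G, hG⟩ := hedge r
  rw [hr.1 n hrn, hG, IncChain.orbitIdeal_edgeIdeal]
  exact (IncChain.regLE_three_orbitGraph G hn).idealReg_le.trans (le_of_eq (by norm_num; rfl))
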